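/- Let $X$ be a real-valued random variable having a probability density with respect to Lebesgue measure on $\mathbb{R}$. For $t>0$ let $X_t = X + Z_t$, where $Z_t \sim N(0,t)$ is a Gaussian random variable with mean $0$ and variance $t$ that is independent of $X$, and let $p_t$ be the probability density of $X_t$. Let $$H(X_t) = -\int_{-\infty}^{\infty} p_t(x)\log p_t(x)\,dx$$ be the differential entropy of $X_t$, and suppose that it is finite for every $t>0$ (the integral converges absolutely). Then the function $t\mapsto H(X_t)$ is four times differentiable on $(0,\infty)$, and $$-\frac{d^4}{dt^4}H(X_t)\ \ge\ 0\qquad\text{for every } t>0.$$ -/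

import Mathlib

open MeasureTheory ProbabilityTheory

/-- `y ↦ p(y) log p(y)`, where `p` is the Lebesgue density of the real random variable `Y`. -/
noncomputable def densityMulLog {Ω : Type*} [MeasurableSpace Ω] (Y : Ω → ℝ) (P : Measure Ω)
    (y : ℝ) : ℝ :=
  (pdf Y P volume y).toReal * Real.log (pdf Y P volume y).toReal

/-- The differential entropy of `Y` is finite: the integral `∫ p log p` converges absolutely. -/
def FiniteDiffEntropy {Ω : Type*} [MeasurableSpace Ω] (Y : Ω → ℝ) (P : Measure Ω) : Prop :=
  Integrable (densityMulLog Y P) volume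

/-- Differential entropy `H(Y) = -∫ p log p` of a real random variable `Y` with Lebesgue
density `p`. -/
noncomputable def diffEntropy {Ω : Type*} [MeasurableSpace Ω] (Y : Ω → ℝ) (P : Measure Ω) : ℝ :=
  -∫ y, densityMulLog Y P y

/-! Only the law μ of X matters: the density p = p_t is the heat flow of μ, smooth and positive,
with ∂_t p = p''/2. Put u_k = p^(k)/p. Functions p·Q(u), with Q a polynomial, are preserved by ∂_x
and ∂_t, each acting on Q through an explicit operator `ratioDeriv`. De Bruijn's identity gives
dH/dt = ½∫p u_1², so the fourth derivative of H is the integral of p times an explicit polynomial.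
By `eval_iterate_ratioDeriv_fisher` that integrand is an x-derivative minus p/2 times a sum of
squares and even monomials with positive coefficients. The x-derivative integrates to zero, so the
sign follows.

For the analysis, u_k(X_t) is the conditional expectation given X_t of a Hermite polynomial in the
Gaussian increment. Jensen's inequality therefore bounds its even moments locally uniformly in t,
and all p·Q(u) are integrable in the same sense (`locUnifIntegrable_flowPoly`). This removes
boundary terms and, through Fubini and the fundamental theorem of calculus, allows differentiation
under the integral without a pointwise majorant.

De Bruijn's identity also needs control of log p. It is bounded above, and the Harnack inequality
bounds log p_t(x) below by log p_r(y), r < t, up to a quadratic cost in x - y. Finite entropy makes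
log p_r integrable against μ, and Gaussian decay absorbs the quadratic. -/

/-! ### Heat kernel derivatives and Hermite polynomials -/

/-- The polynomial factor of the `k`-th spatial derivative of the heat kernel. -/
noncomputable def hermiteFactor : ℕ → ℝ → ℝ → ℝ
  | 0, _, _ => 1
  | 1, t, z => -(z / t)
  | k + 2, t, z => -(z * hermiteFactor (k + 1) t z + (k + 1) * hermiteFactor k t z) / t

/-- The centred Gaussian density of variance `t`. -/
noncomputable def heatKernel (t z : ℝ) : ℝ :=
  (√(2 * Real.pi * t))⁻¹ * Real.exp (-z ^ 2 / (2 * t))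

/-- The `k`-th spatial derivative of the heat kernel. -/
noncomputable def heatKernelDeriv (k : ℕ) (t z : ℝ) : ℝ :=
  heatKernel t z * hermiteFactor k t z

theorem heatKernel_pos {t : ℝ} (ht : 0 < t) (z : ℝ) : 0 < heatKernel t z := by
  unfold heatKernel; positivity

theorem heatKernelDeriv_zero (t z : ℝ) : heatKernelDeriv 0 t z = heatKernel t z := by
  simp [heatKernelDeriv, hermiteFactor]

theorem measurable_hermiteFactor (k : ℕ) :
    Measurable (fun q : ℝ × ℝ => hermiteFactor k q.1 q.2) := by
  induction k using Nat.twoStepInduction with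
  | zero => simp only [hermiteFactor]; fun_prop
  | one => simp only [hermiteFactor]; fun_prop
  | more k h0 h1 => simp only [hermiteFactor]; fun_prop

theorem measurable_heatKernel : Measurable (fun q : ℝ × ℝ => heatKernel q.1 q.2) := by
  unfold heatKernel; fun_prop

theorem measurable_heatKernelDeriv (k : ℕ) :
    Measurable (fun q : ℝ × ℝ => heatKernelDeriv k q.1 q.2) :=
  measurable_heatKernel.mul (measurable_hermiteFactor k)

theorem hasDerivAt_hermiteFactor_space (k : ℕ) (t z : ℝ) :
    HasDerivAt (hermiteFactor (k + 1) t) (-((k + 1) / t) * hermiteFactor k t z) z := by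
  induction k using Nat.twoStepInduction with
  | zero =>
    have e : hermiteFactor (0 + 1) t = fun z => -(z / t) := by
      ext z; simp [hermiteFactor]
    rw [e]
    refine (((hasDerivAt_id z).div_const t).neg).congr_deriv ?_
    simp [hermiteFactor]
  | one =>
    have h1 : HasDerivAt (fun z : ℝ => -(z / t)) (-(1 / t)) z :=
      ((hasDerivAt_id z).div_const t).neg
    have := ((((hasDerivAt_id z).mul h1).add_const 1).neg).div_const t
    have e : hermiteFactor (1 + 1) t
        = fun z => -(id z * -(z / t) + 1) / t := by
      ext z; simp [hermiteFactor]
    rw [e]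
    refine this.congr_deriv ?_
    simp [hermiteFactor]; ring
  | more k h0 h1 =>
    have := ((((hasDerivAt_id z).mul h1).add (h0.const_mul ((k : ℝ) + 1 + 1))).neg).div_const t
    have e : hermiteFactor (k + 2 + 1) t
        = fun z => -(id z * hermiteFactor (k + 2) t z
          + ((k : ℝ) + 1 + 1) * hermiteFactor (k + 1) t z) / t := by
      ext z; rw [hermiteFactor]; push_cast; simp
    rw [e]
    refine this.congr_deriv ?_
    push_cast
    simp only [hermiteFactor, id]
    ring

/-- The heat equation ∂_t(G h_k) = G h_{k+2}/2 for the kernel G, divided by G: subtracting the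
logarithmic derivative ∂_t G / G = h_2/2 leaves this expression. -/
theorem hasDerivAt_hermiteFactor_time (k : ℕ) {t : ℝ} (ht : 0 < t) (z : ℝ) :
    HasDerivAt (fun s => hermiteFactor k s z)
      ((hermiteFactor (k + 2) t z - hermiteFactor k t z * hermiteFactor 2 t z) / 2) t := by
  induction k using Nat.twoStepInduction with
  | zero =>
    simp only [hermiteFactor]
    refine (hasDerivAt_const t 1).congr_deriv ?_
    ring
  | one =>
    simp only [hermiteFactor]
    have := ((hasDerivAt_const t z).div (hasDerivAt_id t) ht.ne').neg
    refine this.congr_deriv ?_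
    simp; field_simp; ring
  | more k h0 h1 =>
    have := (((h1.const_mul z).add (h0.const_mul ((k : ℝ) + 1))).neg).div (hasDerivAt_id t) ht.ne'
    have e : (fun s => hermiteFactor (k + 2) s z)
        = fun s => -(z * hermiteFactor (k + 1) s z
          + ((k : ℝ) + 1) * hermiteFactor k s z) / id s := by
      ext z; rw [hermiteFactor]; simp
    rw [e]
    refine this.congr_deriv ?_
    have e2 (j : ℕ) : hermiteFactor (j + 2) t z =
      -(z * hermiteFactor (j + 1) t z + (j + 1) * hermiteFactor j t z) / t := by
      rw [hermiteFactor]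
    simp only [e2 (k + 2), e2 (k + 1), e2 k, id]
    simp only [hermiteFactor]
    push_cast
    simp
    field_simp
    ring

theorem hasDerivAt_heatKernel_space (t z : ℝ) :
    HasDerivAt (heatKernel t) (-(z / t) * heatKernel t z) z := by
  have h : HasDerivAt (fun z : ℝ => -z ^ 2 / (2 * t)) (-(z / t)) z := by
    refine (((hasDerivAt_id z).pow 2).neg.div_const (2 * t)).congr_deriv ?_
    by_cases h : t = 0
    · simp [h]
    · simp; field_simp
  refine (h.exp.const_mul ((√(2 * Real.pi * t))⁻¹)).congr_deriv ?_
  unfold heatKernel; ring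

theorem hasDerivAt_heatKernel_time {t : ℝ} (ht : 0 < t) (z : ℝ) :
    HasDerivAt (fun s => heatKernel s z) (heatKernel t z * hermiteFactor 2 t z / 2) t := by
  have h : HasDerivAt (fun s : ℝ => -z ^ 2 / (2 * s)) (z ^ 2 / (2 * t ^ 2)) t := by
    refine ((hasDerivAt_const t (-z ^ 2)).div ((hasDerivAt_id t).const_mul 2)
      (by simpa using ht.ne')).congr_deriv ?_
    simp; field_simp
  have h2 : HasDerivAt (fun s : ℝ => (√(2 * Real.pi * s))⁻¹)
      (-(√(2 * Real.pi * t))⁻¹ / (2 * t)) t := by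
    have hp : 0 < 2 * Real.pi * t := by positivity
    refine ((((hasDerivAt_id t).const_mul (2 * Real.pi)).sqrt (by simpa using hp.ne')).inv
      (by simpa using (Real.sqrt_pos.2 hp).ne')).congr_deriv ?_
    have hs : √(2 * Real.pi * t) ^ 2 = 2 * Real.pi * t := Real.sq_sqrt hp.le
    have hs0 : √(2 * Real.pi * t) ≠ 0 := (Real.sqrt_pos.2 hp).ne'
    simp only [id, mul_one]
    rw [hs]
    field_simp
  refine (h2.mul h.exp).congr_deriv ?_
  simp only [heatKernel, hermiteFactor]
  simp
  field_simp

theorem hasDerivAt_heatKernelDeriv_space (k : ℕ) (t z : ℝ) :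
    HasDerivAt (heatKernelDeriv k t) (heatKernelDeriv (k + 1) t z) z := by
  cases k with
  | zero =>
    have e : heatKernelDeriv 0 t = heatKernel t := by ext z; simp [heatKernelDeriv_zero]
    rw [e]
    refine (hasDerivAt_heatKernel_space t z).congr_deriv ?_
    simp [heatKernelDeriv, hermiteFactor]; ring
  | succ k =>
    refine ((hasDerivAt_heatKernel_space t z).mul
      (hasDerivAt_hermiteFactor_space k t z)).congr_deriv ?_
    simp only [heatKernelDeriv, hermiteFactor]
    ring

theorem hasDerivAt_heatKernelDeriv_time (k : ℕ) {t : ℝ} (ht : 0 < t) (z : ℝ) :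
    HasDerivAt (fun s => heatKernelDeriv k s z) (heatKernelDeriv (k + 2) t z / 2) t := by
  refine ((hasDerivAt_heatKernel_time ht z).mul
    (hasDerivAt_hermiteFactor_time k ht z)).congr_deriv ?_
  simp only [heatKernelDeriv]
  ring

/-! ### Gaussian bounds -/

theorem exists_hermiteFactor_le (k : ℕ) {a : ℝ} (ha : 0 < a) :
    ∃ C, 0 ≤ C ∧ ∀ t, a ≤ t → ∀ z, |hermiteFactor k t z| ≤ C * (1 + |z|) ^ k := by
  induction k using Nat.twoStepInduction with
  | zero => exact ⟨1, zero_le_one, fun t _ z => by simp [hermiteFactor]⟩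
  | one =>
    refine ⟨1 / a, by positivity, fun t ht z => ?_⟩
    have h0 : 0 < t := ha.trans_le ht
    simp only [hermiteFactor, abs_neg, abs_div, abs_of_pos h0, pow_one]
    rw [div_mul_eq_mul_div, one_mul]
    gcongr
    linarith
  | more k h0 h1 =>
    obtain ⟨C0, hC0, h0⟩ := h0
    obtain ⟨C1, hC1, h1⟩ := h1
    refine ⟨(C1 + (k + 1) * C0) / a, by positivity, fun t ht z => ?_⟩
    have ht0 : 0 < t := ha.trans_le ht
    have e1 := h1 t ht z
    have e0 := h0 t ht z
    have hz : 0 ≤ |z| := abs_nonneg z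
    simp only [hermiteFactor, abs_neg, abs_div, abs_of_pos ht0]
    rw [div_mul_eq_mul_div]
    apply div_le_div₀ (by positivity) _ ha ht
    have e2 : (1 + |z|) ^ k ≤ (1 + |z|) ^ (k + 2) :=
      pow_le_pow_right₀ (by linarith) (by omega)
    calc |z * hermiteFactor (k + 1) t z + (k + 1) * hermiteFactor k t z|
        ≤ |z| * |hermiteFactor (k + 1) t z| + (k + 1) * |hermiteFactor k t z| := by
          refine (abs_add_le _ _).trans_eq ?_
          rw [abs_mul, abs_mul, abs_of_pos (by positivity : (0 : ℝ) < k + 1)]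
      _ ≤ (1 + |z|) * (C1 * (1 + |z|) ^ (k + 1)) + (k + 1) * (C0 * (1 + |z|) ^ (k + 2)) := by
          gcongr
          · linarith
          · exact e0.trans (by gcongr)
      _ = _ := by ring

/-- A power is dominated by m!·exp(1 + |z|), and |z| ≤ b + z²/(4b) by completing the square. -/
theorem exists_pow_le_exp_sq (m : ℕ) {b : ℝ} (hb : 0 < b) :
    ∃ C, 0 ≤ C ∧ ∀ z : ℝ, (1 + |z|) ^ m ≤ C * Real.exp (z ^ 2 / (4 * b)) := by
  refine ⟨m.factorial * Real.exp (1 + b), by positivity, fun z => ?_⟩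
  have h1 := Real.pow_div_factorial_le_exp (1 + |z|) (by positivity) m
  rw [div_le_iff₀ (by positivity)] at h1
  have h2 : 1 + |z| ≤ 1 + b + z ^ 2 / (4 * b) := by
    have : 0 ≤ (|z| - 2 * b) ^ 2 / (4 * b) := by positivity
    have e : (|z| - 2 * b) ^ 2 / (4 * b) = z ^ 2 / (4 * b) - |z| + b := by
      rw [← sq_abs z]; field_simp; ring
    linarith
  calc (1 + |z|) ^ m ≤ Real.exp (1 + |z|) * m.factorial := h1
    _ ≤ Real.exp (1 + b + z ^ 2 / (4 * b)) * m.factorial := by gcongr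
    _ = _ := by rw [Real.exp_add]; ring

/-- Gaussian domination of the heat kernel times powers of the Hermite factors, uniformly for
times in a compact interval. -/
theorem exists_heatKernel_mul_hermiteFactor_pow_le (k n : ℕ) {a b : ℝ} (ha : 0 < a) (hab : a ≤ b) :
    ∃ C, 0 ≤ C ∧ ∀ t, a ≤ t → t ≤ b → ∀ z,
      heatKernel t z * |hermiteFactor k t z| ^ n ≤ C * Real.exp (-(1 / (4 * b)) * z ^ 2) := by
  obtain ⟨C1, hC1, h1⟩ := exists_hermiteFactor_le k ha
  obtain ⟨C2, hC2, h2⟩ := exists_pow_le_exp_sq (k * n) (ha.trans_le hab)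
  refine ⟨(√(2 * Real.pi * a))⁻¹ * (C1 ^ n * C2), by positivity, fun t hat htb z => ?_⟩
  have ht : 0 < t := ha.trans_le hat
  have hb : 0 < b := ha.trans_le hab
  have e1 : |hermiteFactor k t z| ^ n ≤ C1 ^ n * (C2 * Real.exp (z ^ 2 / (4 * b))) := by
    calc |hermiteFactor k t z| ^ n ≤ (C1 * (1 + |z|) ^ k) ^ n := by
          gcongr; exact h1 t hat z
      _ = C1 ^ n * (1 + |z|) ^ (k * n) := by rw [mul_pow, ← pow_mul]
      _ ≤ _ := by gcongr; exact h2 z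
  -- The prefactor is largest at time a, the exponential at time b. Half of the exponent z²/(2b) is
  -- then spent on the polynomial.
  have e2 : heatKernel t z ≤ (√(2 * Real.pi * a))⁻¹ * Real.exp (-z ^ 2 / (2 * b)) := by
    unfold heatKernel
    have : -z ^ 2 / (2 * t) ≤ -z ^ 2 / (2 * b) := by
      rw [neg_div, neg_div, neg_le_neg_iff]; gcongr
    have := Real.exp_le_exp.2 this
    gcongr
  calc _ ≤ ((√(2 * Real.pi * a))⁻¹ * Real.exp (-z ^ 2 / (2 * b))) *
        (C1 ^ n * (C2 * Real.exp (z ^ 2 / (4 * b)))) := by gcongr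
    _ = (√(2 * Real.pi * a))⁻¹ * (C1 ^ n * C2) *
        (Real.exp (-z ^ 2 / (2 * b)) * Real.exp (z ^ 2 / (4 * b))) := by ring
    _ = _ := by
      rw [← Real.exp_add]; congr 2; field_simp; ring

theorem exists_heatKernelDeriv_le (k : ℕ) {a b : ℝ} (ha : 0 < a) (hab : a ≤ b) :
    ∃ C, 0 ≤ C ∧ ∀ t, a ≤ t → t ≤ b → ∀ z,
      |heatKernelDeriv k t z| ≤ C * Real.exp (-(1 / (4 * b)) * z ^ 2) := by
  obtain ⟨C, hC, h⟩ := exists_heatKernel_mul_hermiteFactor_pow_le k 1 ha hab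
  refine ⟨C, hC, fun t h1 h2 z => ?_⟩
  have := h t h1 h2 z
  rwa [pow_one, ← abs_of_pos (heatKernel_pos (ha.trans_le h1) z), ← abs_mul] at this

/-! ### The heat flow of a measure and its ratios -/

/-- The `k`-th spatial derivative at time `t` of the heat flow started from `μ`. -/
noncomputable def heatFlow (μ : Measure ℝ) (k : ℕ) (t x : ℝ) : ℝ :=
  ∫ y, heatKernelDeriv k t (x - y) ∂μ

theorem exists_heatKernelDeriv_bound (k : ℕ) {a b : ℝ} (ha : 0 < a) (hab : a ≤ b) :
    ∃ C, ∀ t, a ≤ t → t ≤ b → ∀ z, |heatKernelDeriv k t z| ≤ C := by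
  obtain ⟨C, hC, h⟩ := exists_heatKernelDeriv_le k ha hab
  refine ⟨C, fun t h1 h2 z => (h t h1 h2 z).trans ?_⟩
  have hb : 0 < b := ha.trans_le hab
  refine mul_le_of_le_one_right hC (Real.exp_le_one_iff.2 ?_)
  have : 0 ≤ 1 / (4 * b) * z ^ 2 := by positivity
  linarith

theorem measurable_heatKernelDeriv_sub (k : ℕ) (t x : ℝ) :
    Measurable (fun y => heatKernelDeriv k t (x - y)) :=
  (measurable_heatKernelDeriv k).comp (by fun_prop : Measurable fun y : ℝ => (t, x - y))

theorem integrable_heatKernelDeriv_sub (μ : Measure ℝ) [IsFiniteMeasure μ] (k : ℕ) {t : ℝ}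
    (ht : 0 < t) (x : ℝ) : Integrable (fun y => heatKernelDeriv k t (x - y)) μ := by
  obtain ⟨C, h⟩ := exists_heatKernelDeriv_bound k ht le_rfl
  exact Integrable.of_bound (measurable_heatKernelDeriv_sub k t x).aestronglyMeasurable C
    (ae_of_all _ fun y => h t le_rfl le_rfl _)

theorem measurable_heatFlow (μ : Measure ℝ) [IsFiniteMeasure μ] (k : ℕ) :
    Measurable (fun q : ℝ × ℝ => heatFlow μ k q.1 q.2) := by
  have h : Measurable (fun r : (ℝ × ℝ) × ℝ => heatKernelDeriv k r.1.1 (r.1.2 - r.2)) :=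
    (measurable_heatKernelDeriv k).comp
      (by fun_prop : Measurable fun r : (ℝ × ℝ) × ℝ => (r.1.1, r.1.2 - r.2))
  exact (h.stronglyMeasurable.integral_prod_right (ν := μ)).measurable

theorem hasDerivAt_heatFlow_space (μ : Measure ℝ) [IsFiniteMeasure μ] (k : ℕ) {t : ℝ}
    (ht : 0 < t) (x : ℝ) : HasDerivAt (heatFlow μ k t) (heatFlow μ (k + 1) t x) x := by
  obtain ⟨C, h⟩ := exists_heatKernelDeriv_bound (k + 1) ht le_rfl
  refine (hasDerivAt_integral_of_dominated_loc_of_deriv_le (bound := fun _ => C)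
    (F := fun x y => heatKernelDeriv k t (x - y))
    (F' := fun x y => heatKernelDeriv (k + 1) t (x - y)) Filter.univ_mem
    (.of_forall fun x => (measurable_heatKernelDeriv_sub k t x).aestronglyMeasurable)
    (integrable_heatKernelDeriv_sub μ k ht x)
    (measurable_heatKernelDeriv_sub (k + 1) t x).aestronglyMeasurable
    (ae_of_all _ fun y x _ => h t le_rfl le_rfl _) (integrable_const C)
    (ae_of_all _ fun y x _ => ?_)).2
  exact (hasDerivAt_heatKernelDeriv_space k t (x - y)).comp_sub_const x y

theorem hasDerivAt_heatFlow_time (μ : Measure ℝ) [IsFiniteMeasure μ] (k : ℕ) {t : ℝ}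
    (ht : 0 < t) (x : ℝ) :
    HasDerivAt (fun s => heatFlow μ k s x) (heatFlow μ (k + 2) t x / 2) t := by
  obtain ⟨C, h⟩ := exists_heatKernelDeriv_bound (k + 2) (half_pos ht)
    (by linarith : t / 2 ≤ 2 * t)
  have key := (hasDerivAt_integral_of_dominated_loc_of_deriv_le (bound := fun _ => C) (μ := μ)
    (F := fun s y => heatKernelDeriv k s (x - y)) (x₀ := t)
    (F' := fun s y => heatKernelDeriv (k + 2) s (x - y) / 2)
    (Icc_mem_nhds (by linarith : t / 2 < t) (by linarith : t < 2 * t))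
    (.of_forall fun s => (measurable_heatKernelDeriv_sub k s x).aestronglyMeasurable)
    (integrable_heatKernelDeriv_sub μ k ht x)
    ((measurable_heatKernelDeriv_sub (k + 2) t x).div_const 2).aestronglyMeasurable
    (ae_of_all _ fun y s hs => ?_) (integrable_const C)
    (ae_of_all _ fun y s hs => ?_)).2
  · rw [integral_div] at key
    exact key
  · have := h s hs.1 hs.2 (x - y)
    rw [Real.norm_eq_abs, abs_div, abs_two]
    linarith [abs_nonneg (heatKernelDeriv (k + 2) s (x - y))]
  · exact hasDerivAt_heatKernelDeriv_time k ((half_pos ht).trans_le hs.1) (x - y)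

theorem heatFlow_pos (μ : Measure ℝ) [IsProbabilityMeasure μ] {t : ℝ} (ht : 0 < t) (x : ℝ) :
    0 < heatFlow μ 0 t x := by
  have h : ∀ y, 0 < heatKernelDeriv 0 t (x - y) := fun y => by
    rw [heatKernelDeriv_zero]; exact heatKernel_pos ht _
  refine (integral_pos_iff_support_of_nonneg (fun y => (h y).le)
    (integrable_heatKernelDeriv_sub μ 0 ht x)).2 ?_
  have : Function.support (fun y => heatKernelDeriv 0 t (x - y)) = Set.univ := by
    ext y; simpa using (h y).ne'
  rw [this]; simp

/-- The spatial derivatives of the heat flow divided by the flow itself. -/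
noncomputable def heatRatio (μ : Measure ℝ) (k : ℕ) (t x : ℝ) : ℝ :=
  heatFlow μ k t x / heatFlow μ 0 t x

theorem measurable_heatRatio (μ : Measure ℝ) [IsFiniteMeasure μ] (k : ℕ) :
    Measurable (fun q : ℝ × ℝ => heatRatio μ k q.1 q.2) :=
  (measurable_heatFlow μ k).div (measurable_heatFlow μ 0)

theorem hasDerivAt_heatRatio_space (μ : Measure ℝ) [IsProbabilityMeasure μ] (k : ℕ) {t : ℝ}
    (ht : 0 < t) (x : ℝ) :
    HasDerivAt (heatRatio μ k t)
      (heatRatio μ (k + 1) t x - heatRatio μ k t x * heatRatio μ 1 t x) x := by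
  have hp := (heatFlow_pos μ ht x).ne'
  refine ((hasDerivAt_heatFlow_space μ k ht x).div
    (hasDerivAt_heatFlow_space μ 0 ht x) hp).congr_deriv ?_
  unfold heatRatio
  field_simp

theorem hasDerivAt_heatRatio_time (μ : Measure ℝ) [IsProbabilityMeasure μ] (k : ℕ) {t : ℝ}
    (ht : 0 < t) (x : ℝ) :
    HasDerivAt (fun s => heatRatio μ k s x)
      (1 / 2 * (heatRatio μ (k + 2) t x - heatRatio μ k t x * heatRatio μ 2 t x)) t := by
  have hp := (heatFlow_pos μ ht x).ne'
  refine ((hasDerivAt_heatFlow_time μ k ht x).div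
    (hasDerivAt_heatFlow_time μ 0 ht x) hp).congr_deriv ?_
  unfold heatRatio
  field_simp

/-! ### Jensen's inequality for the ratios -/

/-- Convolving an integrable function with an integrable weight against `μ`. -/
theorem integrable_prod_sub_mul (μ : Measure ℝ) [SFinite μ] {e w : ℝ → ℝ}
    (he : Integrable e) (hem : Measurable e) (hw : Integrable w μ) :
    Integrable (fun q : ℝ × ℝ => e (q.1 - q.2) * w q.2) (volume.prod μ) := by
  have hm : AEStronglyMeasurable (fun q : ℝ × ℝ => e (q.1 - q.2) * w q.2) (volume.prod μ) :=
    (hem.comp (by fun_prop : Measurable fun q : ℝ × ℝ => q.1 - q.2)).aestronglyMeasurable.mul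
      hw.aestronglyMeasurable.comp_snd
  rw [integrable_prod_iff' hm]
  refine ⟨ae_of_all _ fun y => (he.comp_sub_right y).mul_const (w y), ?_⟩
  simp only [norm_mul, integral_mul_const]
  simp only [integral_sub_right_eq_self (fun x => ‖e x‖)]
  exact hw.norm.const_mul _

theorem integral_integral_sub_mul (μ : Measure ℝ) [SFinite μ] {e w : ℝ → ℝ}
    (he : Integrable e) (hem : Measurable e) (hw : Integrable w μ) :
    ∫ x, ∫ y, e (x - y) * w y ∂μ = (∫ z, e z) * ∫ y, w y ∂μ := by
  rw [integral_integral_swap (integrable_prod_sub_mul μ he hem hw)]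
  simp only [integral_mul_const, integral_sub_right_eq_self e]
  rw [integral_const_mul]

/-- Convexity of an even power: Bernoulli's inequality for h/c. Integrated with c the mean of h, the
linear term vanishes and Jensen's inequality results. -/
theorem pow_tangent_le (n : ℕ) (c h : ℝ) :
    c ^ (2 * n) + 2 * n * c ^ (2 * n - 1) * (h - c) ≤ h ^ (2 * n) := by
  rcases Nat.eq_zero_or_pos n with rfl | hn
  · simp
  rcases eq_or_ne c 0 with rfl | hc
  · have : 2 * n - 1 ≠ 0 := by omega
    simp [this, hn.ne']
    rw [pow_mul]; positivity
  have key : 1 + ((2 * n : ℕ) : ℝ) * ((h - c) / c) ≤ (1 + (h - c) / c) ^ (2 * n) := by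
    -- Bernoulli's inequality holds down to -2; below that its left side is negative while the even
    -- power is not.
    rcases le_or_gt (-2) ((h - c) / c) with h1 | h1
    · exact one_add_mul_le_pow h1 _
    · have : (0 : ℝ) ≤ (1 + (h - c) / c) ^ (2 * n) := by rw [pow_mul]; positivity
      have hn' : (1 : ℝ) ≤ n := by exact_mod_cast hn
      push_cast
      nlinarith
  have hc2 : 0 < c ^ (2 * n) := by rw [pow_mul]; positivity
  have := mul_le_mul_of_nonneg_left key hc2.le
  rw [← mul_pow] at this
  have e1 : c * (1 + (h - c) / c) = h := by field_simp; ring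
  rw [e1] at this
  refine le_trans (le_of_eq ?_) this
  obtain ⟨m, hm⟩ : ∃ m, 2 * n = m + 1 := ⟨2 * n - 1, by omega⟩
  have e2 : (2 * (n : ℝ)) = ((m + 1 : ℕ) : ℝ) := by rw [← hm]; push_cast; ring
  rw [hm, e2, Nat.add_sub_cancel, pow_succ]
  field_simp

theorem integrable_exp_neg_sq {b : ℝ} (hb : 0 < b) :
    Integrable (fun z : ℝ => Real.exp (-(1 / (4 * b)) * z ^ 2)) :=
  integrable_exp_neg_mul_sq (by positivity)

/-- Jensen's inequality for the ratios: they are conditional expectations. -/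
theorem heatFlow_mul_heatRatio_pow_le (μ : Measure ℝ) [IsProbabilityMeasure μ] (k n : ℕ) {t : ℝ}
    (ht : 0 < t) (x : ℝ) :
    heatFlow μ 0 t x * heatRatio μ k t x ^ (2 * n) ≤
      ∫ y, heatKernel t (x - y) * |hermiteFactor k t (x - y)| ^ (2 * n) ∂μ := by
  set c := heatRatio μ k t x with hc
  have hp := (heatFlow_pos μ ht x).ne'
  have i0 := integrable_heatKernelDeriv_sub μ 0 ht x
  have ik := integrable_heatKernelDeriv_sub μ k ht x
  have id : Integrable (fun y => heatKernelDeriv k t (x - y) - c * heatKernelDeriv 0 t (x - y)) μ :=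
    ik.sub (i0.const_mul c)
  have hint : ∫ y, (c ^ (2 * n) * heatKernelDeriv 0 t (x - y) +
      2 * n * c ^ (2 * n - 1) *
        (heatKernelDeriv k t (x - y) - c * heatKernelDeriv 0 t (x - y))) ∂μ =
      heatFlow μ 0 t x * c ^ (2 * n) := by
    rw [integral_add (i0.const_mul _) (id.const_mul _),
      integral_const_mul, integral_const_mul, integral_sub ik (i0.const_mul _),
      integral_const_mul]
    change c ^ (2 * n) * heatFlow μ 0 t x + 2 * n * c ^ (2 * n - 1) *
      (heatFlow μ k t x - c * heatFlow μ 0 t x) = _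
    -- c is exactly the mean of the Hermite factor under the normalised kernel weight, so the
    -- first-order term integrates to zero.
    have : heatFlow μ k t x - c * heatFlow μ 0 t x = 0 := by
      rw [hc, heatRatio]; field_simp; ring
    rw [this]; ring
  rw [← hint]
  obtain ⟨C, hC, h⟩ := exists_heatKernel_mul_hermiteFactor_pow_le k (2 * n) ht le_rfl
  refine integral_mono ((i0.const_mul _).add (id.const_mul _)) ?_ ?_
  · refine Integrable.of_bound (C := C) ?_ (ae_of_all _ fun y => ?_)
    · have m1 := measurable_heatKernel.comp
        (by fun_prop : Measurable fun y : ℝ => (t, x - y))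
      have m2 := (measurable_hermiteFactor k).comp
        (by fun_prop : Measurable fun y : ℝ => (t, x - y))
      exact (m1.mul (m2.abs.pow_const (2 * n))).aestronglyMeasurable
    · have hz := h t le_rfl le_rfl (x - y)
      have hpos := heatKernel_pos ht (x - y)
      rw [Real.norm_of_nonneg (by positivity)]
      refine hz.trans (mul_le_of_le_one_right hC (Real.exp_le_one_iff.2 ?_))
      have : 0 ≤ 1 / (4 * t) * (x - y) ^ 2 := by positivity
      linarith
  · intro y
    have h1 := pow_tangent_le n c (hermiteFactor k t (x - y))
    have h2 : |hermiteFactor k t (x - y)| ^ (2 * n) = hermiteFactor k t (x - y) ^ (2 * n) := by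
      rw [pow_mul, sq_abs, ← pow_mul]
    have := mul_le_mul_of_nonneg_left h1 (heatKernel_pos ht (x - y)).le
    simp only [heatKernelDeriv_zero]
    rw [h2]
    refine le_trans (le_of_eq ?_) this
    simp only [heatKernelDeriv]
    ring

/-! ### Integrability locally uniform in time -/

/-- A family of functions of time and space is integrable in space, locally uniformly in time. -/
def LocUnifIntegrable (F : ℝ → ℝ → ℝ) : Prop :=
  ∀ a b, 0 < a → a ≤ b → ∃ C, ∀ t, a ≤ t → t ≤ b → Integrable (F t) ∧ ∫ x, |F t x| ≤ C

theorem LocUnifIntegrable.mono {F G : ℝ → ℝ → ℝ} (hG : LocUnifIntegrable G)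
    (hm : Measurable (Function.uncurry F)) (h : ∀ t, 0 < t → ∀ x, |F t x| ≤ |G t x|) :
    LocUnifIntegrable F := by
  intro a b ha hab
  obtain ⟨C, hC⟩ := hG a b ha hab
  refine ⟨C, fun t h1 h2 => ?_⟩
  obtain ⟨hi, hle⟩ := hC t h1 h2
  have hF : Integrable (F t) :=
    hi.mono (hm.comp measurable_prodMk_left).aestronglyMeasurable
      (ae_of_all _ fun x => h t (ha.trans_le h1) x)
  exact ⟨hF, (integral_mono hF.abs hi.abs (h t (ha.trans_le h1))).trans hle⟩

theorem LocUnifIntegrable.add {F G : ℝ → ℝ → ℝ} (hF : LocUnifIntegrable F)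
    (hG : LocUnifIntegrable G) : LocUnifIntegrable (fun t x => F t x + G t x) := by
  intro a b ha hab
  obtain ⟨C, hC⟩ := hF a b ha hab
  obtain ⟨C', hC'⟩ := hG a b ha hab
  refine ⟨C + C', fun t h1 h2 => ?_⟩
  obtain ⟨hi, hle⟩ := hC t h1 h2
  obtain ⟨hi', hle'⟩ := hC' t h1 h2
  refine ⟨hi.add hi', ?_⟩
  calc ∫ x, |F t x + G t x| ≤ ∫ x, (|F t x| + |G t x|) :=
        integral_mono (hi.add hi').abs (hi.abs.add hi'.abs) fun x => abs_add_le _ _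
    _ = (∫ x, |F t x|) + ∫ x, |G t x| := integral_add hi.abs hi'.abs
    _ ≤ _ := by linarith

theorem LocUnifIntegrable.const_mul {F : ℝ → ℝ → ℝ} (c : ℝ) (hF : LocUnifIntegrable F) :
    LocUnifIntegrable (fun t x => c * F t x) := by
  intro a b ha hab
  obtain ⟨C, hC⟩ := hF a b ha hab
  refine ⟨|c| * C, fun t h1 h2 => ⟨(hC t h1 h2).1.const_mul c, ?_⟩⟩
  simp only [abs_mul, integral_const_mul]
  gcongr
  exact (hC t h1 h2).2

/-- Bounding a family by averages over `μ` of translates of an integrable profile. -/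
theorem locUnifIntegrable_of_le_integral (μ : Measure ℝ) [SFinite μ] {F : ℝ → ℝ → ℝ}
    (hm : Measurable (Function.uncurry F))
    (h : ∀ a b, 0 < a → a ≤ b → ∃ (e w : ℝ → ℝ), Integrable e ∧ Measurable e ∧ Integrable w μ ∧
      ∀ t, a ≤ t → t ≤ b → ∀ x, |F t x| ≤ ∫ y, e (x - y) * w y ∂μ) :
    LocUnifIntegrable F := by
  intro a b ha hab
  obtain ⟨e, w, he, hem, hw, hle⟩ := h a b ha hab
  have hi := (integrable_prod_sub_mul μ he hem hw).integral_prod_left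
  refine ⟨(∫ z, e z) * ∫ y, w y ∂μ, fun t h1 h2 => ?_⟩
  have hF : Integrable (F t) :=
    hi.mono' (hm.comp measurable_prodMk_left).aestronglyMeasurable
      (ae_of_all _ fun x => hle t h1 h2 x)
  refine ⟨hF, (integral_mono hF.abs hi (hle t h1 h2)).trans_eq ?_⟩
  exact integral_integral_sub_mul μ he hem hw

theorem measurable_uncurry_heatFlow_mul (μ : Measure ℝ) [IsFiniteMeasure μ] {f : ℝ → ℝ → ℝ}
    (hf : Measurable (Function.uncurry f)) :
    Measurable (Function.uncurry fun t x => heatFlow μ 0 t x * f t x) :=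
  (measurable_heatFlow μ 0).mul hf

theorem locUnifIntegrable_heatRatio_pow (μ : Measure ℝ) [IsProbabilityMeasure μ] (k n : ℕ) :
    LocUnifIntegrable (fun t x => heatFlow μ 0 t x * heatRatio μ k t x ^ (2 * n)) := by
  refine locUnifIntegrable_of_le_integral μ
    (measurable_uncurry_heatFlow_mul μ ((measurable_heatRatio μ k).pow_const (2 * n)))
    fun a b ha hab => ?_
  obtain ⟨C, hC, h⟩ := exists_heatKernel_mul_hermiteFactor_pow_le k (2 * n) ha hab
  have hi := (integrable_exp_neg_sq (ha.trans_le hab)).const_mul C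
  refine ⟨fun z => C * Real.exp (-(1 / (4 * b)) * z ^ 2), fun _ => 1, hi, by fun_prop,
    integrable_const 1, fun t h1 h2 x => ?_⟩
  have ht := ha.trans_le h1
  have h0 : 0 ≤ heatRatio μ k t x ^ (2 * n) := by rw [pow_mul]; positivity
  rw [abs_of_nonneg (mul_nonneg (heatFlow_pos μ ht x).le h0)]
  refine (heatFlow_mul_heatRatio_pow_le μ k n ht x).trans ?_
  simp only [mul_one]
  refine integral_mono_of_nonneg (ae_of_all _ fun y => ?_) ?_ (ae_of_all _ fun y => h t h1 h2 _)
  · have := heatKernel_pos ht (x - y)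
    positivity
  · refine Integrable.of_bound (C := C) (by fun_prop) (ae_of_all _ fun y => ?_)
    rw [Real.norm_of_nonneg (by positivity)]
    refine mul_le_of_le_one_right hC (Real.exp_le_one_iff.2 ?_)
    have hb := ha.trans_le hab
    have : 0 ≤ 1 / (4 * b) * (x - y) ^ 2 := by positivity
    linarith

/-! ### Polynomials in the ratios -/

/-- A polynomial in the ratios. -/
noncomputable def ratioEval (μ : Measure ℝ) (Q : MvPolynomial ℕ ℝ) (t x : ℝ) : ℝ :=
  MvPolynomial.eval (fun k => heatRatio μ k t x) Q

/-- The heat flow times a polynomial in the ratios. -/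
noncomputable def flowPoly (μ : Measure ℝ) (Q : MvPolynomial ℕ ℝ) (t x : ℝ) : ℝ :=
  heatFlow μ 0 t x * ratioEval μ Q t x

theorem measurable_ratioEval (μ : Measure ℝ) [IsFiniteMeasure μ] (Q : MvPolynomial ℕ ℝ) :
    Measurable (Function.uncurry (ratioEval μ Q)) := by
  unfold ratioEval Function.uncurry
  induction Q using MvPolynomial.induction_on with
  | C c => simp
  | add P Q hP hQ => simpa using hP.fun_add hQ
  | mul_X Q k hQ => simpa using hQ.fun_mul (measurable_heatRatio μ k)

theorem measurable_flowPoly (μ : Measure ℝ) [IsFiniteMeasure μ] (Q : MvPolynomial ℕ ℝ) :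
    Measurable (Function.uncurry (flowPoly μ Q)) :=
  measurable_uncurry_heatFlow_mul μ (measurable_ratioEval μ Q)

/-- AB is controlled by A² + B², which doubles the exponent. This is why all even moments are
carried together. -/
theorem locUnifIntegrable_mul_pow (μ : Measure ℝ) [IsProbabilityMeasure μ]
    {f g : ℝ → ℝ → ℝ} (hf : Measurable (Function.uncurry f)) (hg : Measurable (Function.uncurry g))
    (Hf : ∀ n, LocUnifIntegrable fun t x => heatFlow μ 0 t x * f t x ^ (2 * n))
    (Hg : ∀ n, LocUnifIntegrable fun t x => heatFlow μ 0 t x * g t x ^ (2 * n)) (n : ℕ) :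
    LocUnifIntegrable fun t x => heatFlow μ 0 t x * (f t x * g t x) ^ (2 * n) := by
  refine ((Hf (2 * n)).add (Hg (2 * n))).mono
    (measurable_uncurry_heatFlow_mul μ ((hf.mul hg).pow_const (2 * n))) fun t ht x => ?_
  have hp := heatFlow_pos μ ht x
  rw [← mul_add, abs_mul, abs_mul]
  refine mul_le_mul_of_nonneg_left ?_ (abs_nonneg _)
  set A := f t x ^ (2 * n) with hA
  set B := g t x ^ (2 * n) with hB
  have eA : f t x ^ (2 * (2 * n)) = A ^ 2 := by rw [hA, ← pow_mul]; ring_nf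
  have eB : g t x ^ (2 * (2 * n)) = B ^ 2 := by rw [hB, ← pow_mul]; ring_nf
  have eAB : (f t x * g t x) ^ (2 * n) = A * B := by rw [mul_pow]
  rw [eA, eB, eAB, abs_of_nonneg (by positivity : 0 ≤ A ^ 2 + B ^ 2), abs_le]
  constructor <;> nlinarith [sq_nonneg (A + B), sq_nonneg (A - B), sq_nonneg A, sq_nonneg B]

theorem locUnifIntegrable_add_pow (μ : Measure ℝ) [IsProbabilityMeasure μ]
    {f g : ℝ → ℝ → ℝ} (hf : Measurable (Function.uncurry f)) (hg : Measurable (Function.uncurry g))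
    (Hf : ∀ n, LocUnifIntegrable fun t x => heatFlow μ 0 t x * f t x ^ (2 * n))
    (Hg : ∀ n, LocUnifIntegrable fun t x => heatFlow μ 0 t x * g t x ^ (2 * n)) (n : ℕ) :
    LocUnifIntegrable fun t x => heatFlow μ 0 t x * (f t x + g t x) ^ (2 * n) := by
  refine (((Hf n).add (Hg n)).const_mul (2 ^ (2 * n - 1))).mono
    (measurable_uncurry_heatFlow_mul μ ((hf.add hg).pow_const (2 * n))) fun t ht x => ?_
  have hp := heatFlow_pos μ ht x
  have hev : Even (2 * n) := even_two_mul n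
  rw [← mul_add, mul_left_comm, abs_mul, abs_mul]
  refine mul_le_mul_of_nonneg_left ?_ (abs_nonneg _)
  rw [abs_of_nonneg (hev.pow_nonneg _)]
  exact (hev.add_pow_le).trans (le_abs_self _)

theorem locUnifIntegrable_ratioEval_pow (μ : Measure ℝ) [IsProbabilityMeasure μ]
    (Q : MvPolynomial ℕ ℝ) (n : ℕ) :
    LocUnifIntegrable fun t x => heatFlow μ 0 t x * ratioEval μ Q t x ^ (2 * n) := by
  induction Q using MvPolynomial.induction_on generalizing n with
  | C c =>
    -- The zeroth power makes this the integrability of p itself.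
    have := (locUnifIntegrable_heatRatio_pow μ 0 0).const_mul (c ^ (2 * n))
    simpa [ratioEval, mul_comm] using this
  | add P Q hP hQ =>
    have := locUnifIntegrable_add_pow μ (measurable_ratioEval μ P) (measurable_ratioEval μ Q) hP hQ n
    simpa [ratioEval] using this
  | mul_X Q k hQ =>
    have := locUnifIntegrable_mul_pow μ (g := heatRatio μ k) (measurable_ratioEval μ Q) (measurable_heatRatio μ k) hQ
      (locUnifIntegrable_heatRatio_pow μ k) n
    simpa [ratioEval] using this

/-- Since |Q| ≤ 1 + Q², the even moments of orders 0 and 2 suffice. -/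
theorem locUnifIntegrable_flowPoly (μ : Measure ℝ) [IsProbabilityMeasure μ]
    (Q : MvPolynomial ℕ ℝ) : LocUnifIntegrable (flowPoly μ Q) := by
  refine ((locUnifIntegrable_ratioEval_pow μ Q 0).add
    (locUnifIntegrable_ratioEval_pow μ Q 1)).mono (measurable_flowPoly μ Q) fun t ht x => ?_
  have hp := heatFlow_pos μ ht x
  rw [← mul_add, abs_mul, flowPoly, abs_mul]
  refine mul_le_mul_of_nonneg_left ?_ (abs_nonneg _)
  rw [mul_zero, pow_zero, mul_one, abs_of_nonneg (by positivity : 0 ≤ 1 + ratioEval μ Q t x ^ 2),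
    abs_le]
  constructor <;> nlinarith [sq_nonneg (ratioEval μ Q t x + 1), sq_nonneg (ratioEval μ Q t x - 1)]

/-- The operator on polynomials in the ratios `u_k` induced by a derivation sending `p` to
`c * p * u_s` and `u_k` to `c * (u_{k+s} - u_k * u_s)`. -/
noncomputable def ratioDeriv (s : ℕ) (c : ℝ) (Q : MvPolynomial ℕ ℝ) : MvPolynomial ℕ ℝ :=
  MvPolynomial.C c * (MvPolynomial.X s * Q +
    MvPolynomial.mkDerivation ℝ
      (fun k => MvPolynomial.X (k + s) - MvPolynomial.X k * MvPolynomial.X s) Q)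

/-- One chain rule serves both variables: shift s = 1, factor c = 1 for space, and s = 2, c = 1/2
for time by the heat equation. -/
theorem hasDerivAt_eval_of_ratioDeriv {p : ℝ → ℝ} {u : ℕ → ℝ → ℝ} {s : ℕ} {c τ : ℝ}
    (hp : HasDerivAt p (c * (p τ * u s τ)) τ)
    (hu : ∀ k, HasDerivAt (u k) (c * (u (k + s) τ - u k τ * u s τ)) τ) (Q : MvPolynomial ℕ ℝ) :
    HasDerivAt (fun σ => p σ * MvPolynomial.eval (fun k => u k σ) Q)
      (p τ * MvPolynomial.eval (fun k => u k τ) (ratioDeriv s c Q)) τ := by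
  have key : HasDerivAt (fun σ => MvPolynomial.eval (fun k => u k σ) Q)
      (c * MvPolynomial.eval (fun k => u k τ) (MvPolynomial.mkDerivation ℝ
        (fun k => MvPolynomial.X (k + s) - MvPolynomial.X k * MvPolynomial.X s) Q)) τ := by
    induction Q using MvPolynomial.induction_on with
    | C a => simpa using hasDerivAt_const τ a
    | add P Q hP hQ => simpa [mul_add] using hP.fun_add hQ
    | mul_X Q k hQ =>
      have := hQ.fun_mul (hu k)
      simp only [map_mul, MvPolynomial.eval_X]
      refine this.congr_deriv ?_
      rw [Derivation.leibniz, MvPolynomial.mkDerivation_X]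
      simp
      ring
  refine (hp.fun_mul key).congr_deriv ?_
  simp [ratioDeriv]
  ring

theorem hasDerivAt_flowPoly_space (μ : Measure ℝ) [IsProbabilityMeasure μ]
    (Q : MvPolynomial ℕ ℝ) {t : ℝ} (ht : 0 < t) (x : ℝ) :
    HasDerivAt (flowPoly μ Q t) (flowPoly μ (ratioDeriv 1 1 Q) t x) x := by
  refine hasDerivAt_eval_of_ratioDeriv (u := fun k x => heatRatio μ k t x) ?_
    (fun k => (hasDerivAt_heatRatio_space μ k ht x).congr_deriv (by ring)) Q
  have hp := (heatFlow_pos μ ht x).ne'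
  refine (hasDerivAt_heatFlow_space μ 0 ht x).congr_deriv ?_
  simp only [heatRatio]
  field_simp

theorem hasDerivAt_flowPoly_time (μ : Measure ℝ) [IsProbabilityMeasure μ]
    (Q : MvPolynomial ℕ ℝ) {t : ℝ} (ht : 0 < t) (x : ℝ) :
    HasDerivAt (fun s => flowPoly μ Q s x) (flowPoly μ (ratioDeriv 2 (1 / 2) Q) t x) t := by
  refine hasDerivAt_eval_of_ratioDeriv (p := fun s => heatFlow μ 0 s x)
    (u := fun k s => heatRatio μ k s x) ?_
    (fun k => hasDerivAt_heatRatio_time μ k ht x) Q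
  have hp := (heatFlow_pos μ ht x).ne'
  refine (hasDerivAt_heatFlow_time μ 0 ht x).congr_deriv ?_
  simp only [heatRatio]
  field_simp

/-- The integrand is an x-derivative; as it and its primitive are both integrable, there is no
boundary contribution. -/
theorem integral_flowPoly_ratioDeriv_space (μ : Measure ℝ) [IsProbabilityMeasure μ]
    (Q : MvPolynomial ℕ ℝ) {t : ℝ} (ht : 0 < t) :
    ∫ x, flowPoly μ (ratioDeriv 1 1 Q) t x = 0 := by
  obtain ⟨_, h1⟩ := locUnifIntegrable_flowPoly μ (ratioDeriv 1 1 Q) t t ht le_rfl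
  obtain ⟨_, h2⟩ := locUnifIntegrable_flowPoly μ Q t t ht le_rfl
  exact integral_eq_zero_of_hasDerivAt_of_integrable
    (fun x => hasDerivAt_flowPoly_space μ Q ht x)
    (h1 t le_rfl le_rfl).1 (h2 t le_rfl le_rfl).1

theorem LocUnifIntegrable.integrable {F : ℝ → ℝ → ℝ} (hF : LocUnifIntegrable F) {t : ℝ}
    (ht : 0 < t) : Integrable (F t) := by
  obtain ⟨_, h⟩ := hF t t ht le_rfl
  exact (h t le_rfl le_rfl).1

/-! ### Differentiation under the integral -/

/-- The fundamental theorem of calculus under a spatial integral. -/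
theorem integral_sub_eq_intervalIntegral {F F' : ℝ → ℝ → ℝ}
    (hd : ∀ t, 0 < t → ∀ x, HasDerivAt (fun s => F s x) (F' t x) t)
    (hc : ∀ x, ContinuousOn (fun s => F' s x) (Set.Ioi 0))
    (hm : Measurable (Function.uncurry F')) (hF : ∀ t, 0 < t → Integrable (F t))
    (hF' : LocUnifIntegrable F') {a b : ℝ} (ha : 0 < a) (hab : a ≤ b) :
    (∫ x, F b x) - ∫ x, F a x = ∫ s in a..b, ∫ x, F' s x := by
  obtain ⟨C, hC⟩ := hF' a b ha hab
  have hsub : Set.uIcc a b ⊆ Set.Ioi 0 := by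
    rw [Set.uIcc_of_le hab]; exact fun s hs => ha.trans_le hs.1
  have e (x : ℝ) : F b x - F a x = ∫ s in a..b, F' s x :=
    (intervalIntegral.integral_eq_sub_of_hasDerivAt (fun s hs => hd s (hsub hs) x)
      ((hc x).mono hsub).intervalIntegrable).symm
  rw [← integral_sub (hF b (ha.trans_le hab)) (hF a ha)]
  simp only [e, intervalIntegral.integral_of_le hab]
  refine integral_integral_swap ?_
  have hs : AEStronglyMeasurable (fun q : ℝ × ℝ => F' q.2 q.1)
      (volume.prod (volume.restrict (Set.Ioc a b))) :=
    (hm.comp measurable_swap).aestronglyMeasurable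
  change Integrable (fun q : ℝ × ℝ => F' q.2 q.1) _
  rw [integrable_prod_iff' hs]
  have hmem : ∀ᵐ s ∂(volume.restrict (Set.Ioc a b)), s ∈ Set.Ioc a b :=
    ae_restrict_mem measurableSet_Ioc
  refine ⟨hmem.mono fun s hs => (hC s hs.1.le hs.2).1, ?_⟩
  refine Integrable.of_bound (C := C) hs.norm.prod_swap.integral_prod_right' (hmem.mono fun s hs => ?_)
  rw [Real.norm_of_nonneg (integral_nonneg fun x => norm_nonneg _)]
  exact (hC s hs.1.le hs.2).2

/-- A local bound on ∫|F'| is a local Lipschitz constant for ∫F. -/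
theorem continuousOn_integral {F F' : ℝ → ℝ → ℝ}
    (hd : ∀ t, 0 < t → ∀ x, HasDerivAt (fun s => F s x) (F' t x) t)
    (hc : ∀ x, ContinuousOn (fun s => F' s x) (Set.Ioi 0))
    (hm : Measurable (Function.uncurry F')) (hF : ∀ t, 0 < t → Integrable (F t))
    (hF' : LocUnifIntegrable F') : ContinuousOn (fun s => ∫ x, F s x) (Set.Ioi 0) := by
  intro t ht
  have ht : 0 < t := ht
  refine ContinuousAt.continuousWithinAt ?_
  obtain ⟨C, hC⟩ := hF' (t / 2) (2 * t) (by linarith) (by linarith)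
  have hnhds : Set.Icc (t / 2) (2 * t) ∈ nhds t := Icc_mem_nhds (by linarith) (by linarith)
  have hlip : ∀ a ∈ Set.Icc (t / 2) (2 * t), ∀ b ∈ Set.Icc (t / 2) (2 * t), a ≤ b →
      |(∫ x, F b x) - ∫ x, F a x| ≤ C * |b - a| := by
    intro a haI b hbI hab
    rw [integral_sub_eq_intervalIntegral hd hc hm hF hF' (by linarith [haI.1]) hab,
      ← Real.norm_eq_abs]
    refine intervalIntegral.norm_integral_le_of_norm_le_const fun s hs => ?_
    rw [Set.uIoc_of_le hab] at hs
    refine (norm_integral_le_integral_norm _).trans ?_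
    exact (hC s (haI.1.trans hs.1.le) (hs.2.trans hbI.2)).2
  have htI : t ∈ Set.Icc (t / 2) (2 * t) := ⟨by linarith, by linarith⟩
  rw [ContinuousAt, tendsto_iff_norm_sub_tendsto_zero]
  have hlim : Filter.Tendsto (fun s => C * |s - t|) (nhds t) (nhds 0) := by
    have : Continuous fun s => C * |s - t| := by fun_prop
    simpa using this.tendsto t
  refine squeeze_zero' (.of_forall fun s => norm_nonneg _) ?_ hlim
  filter_upwards [hnhds] with s hs
  rw [Real.norm_eq_abs]
  rcases le_total t s with h | h
  · exact hlip t htI s hs h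
  · rw [abs_sub_comm, abs_sub_comm s]
    exact hlip s hs t htI h

/-- Differentiation under the integral sign with integral bounds on the derivative instead of a
pointwise domination. -/
theorem hasDerivAt_integral_of_locUnifIntegrable {F F' : ℝ → ℝ → ℝ}
    (hd : ∀ t, 0 < t → ∀ x, HasDerivAt (fun s => F s x) (F' t x) t)
    (hc : ∀ x, ContinuousOn (fun s => F' s x) (Set.Ioi 0))
    (hm : Measurable (Function.uncurry F')) (hF : ∀ t, 0 < t → Integrable (F t))
    (hF' : LocUnifIntegrable F') (hcont : ContinuousOn (fun s => ∫ x, F' s x) (Set.Ioi 0))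
    {t : ℝ} (ht : 0 < t) :
    HasDerivAt (fun s => ∫ x, F s x) (∫ x, F' t x) t := by
  have ha : 0 < t / 2 := half_pos ht
  have hint : IntervalIntegrable (fun s => ∫ x, F' s x) volume (t / 2) t := by
    refine (hcont.mono ?_).intervalIntegrable
    rw [Set.uIcc_of_le (by linarith)]
    exact fun s hs => ha.trans_le hs.1
  have hat : ContinuousAt (fun s => ∫ x, F' s x) t := hcont.continuousAt (Ioi_mem_nhds ht)
  have key := intervalIntegral.integral_hasDerivAt_right hint
    (ContinuousOn.stronglyMeasurableAtFilter isOpen_Ioi hcont t ht) hat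
  refine (key.add_const (∫ x, F (t / 2) x)).congr_of_eventuallyEq ?_
  filter_upwards [Ioi_mem_nhds (by linarith : t / 2 < t)] with s hs
  rw [← integral_sub_eq_intervalIntegral hd hc hm hF hF' ha (le_of_lt hs)]
  ring

theorem hasDerivAt_integral_flowPoly (μ : Measure ℝ) [IsProbabilityMeasure μ]
    (Q : MvPolynomial ℕ ℝ) {t : ℝ} (ht : 0 < t) :
    HasDerivAt (fun s => ∫ x, flowPoly μ Q s x)
      (∫ x, flowPoly μ (ratioDeriv 2 (1 / 2) Q) t x) t := by
  have hc (P : MvPolynomial ℕ ℝ) (x : ℝ) :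
      ContinuousOn (fun s => flowPoly μ P s x) (Set.Ioi 0) := fun s hs =>
    (hasDerivAt_flowPoly_time μ P hs x).continuousAt.continuousWithinAt
  refine hasDerivAt_integral_of_locUnifIntegrable
    (fun s hs x => hasDerivAt_flowPoly_time μ Q hs x) (hc _) (measurable_flowPoly μ _)
    (fun s hs => (locUnifIntegrable_flowPoly μ Q).integrable hs)
    (locUnifIntegrable_flowPoly μ _) ?_ ht
  -- The time derivative is again p times a polynomial in the ratios, so its own time derivative
  -- obeys the same bounds.
  exact continuousOn_integral
    (fun s hs x => hasDerivAt_flowPoly_time μ _ hs x) (hc _) (measurable_flowPoly μ _)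
    (fun s hs => (locUnifIntegrable_flowPoly μ _).integrable hs) (locUnifIntegrable_flowPoly μ _)

/-! ### Harnack inequality and control of log p -/

theorem heatKernel_eq_gaussianPDFReal {t : ℝ} (ht : 0 < t) (z : ℝ) :
    heatKernel t z = gaussianPDFReal 0 t.toNNReal z := by
  simp [heatKernel, gaussianPDFReal, Real.coe_toNNReal _ ht.le]

theorem integral_heatKernel {t : ℝ} (ht : 0 < t) : ∫ z, heatKernel t z = 1 := by
  simp only [heatKernel_eq_gaussianPDFReal ht]
  exact integral_gaussianPDFReal_eq_one 0 (by simpa using ht)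

theorem heatKernel_le {a t : ℝ} (ha : 0 < a) (hat : a ≤ t) (z : ℝ) :
    heatKernel t z ≤ (√(2 * Real.pi * a))⁻¹ := by
  have ht := ha.trans_le hat
  have h1 : Real.exp (-z ^ 2 / (2 * t)) ≤ 1 := by
    rw [Real.exp_le_one_iff, neg_div]
    have : 0 ≤ z ^ 2 / (2 * t) := by positivity
    linarith
  calc heatKernel t z ≤ (√(2 * Real.pi * t))⁻¹ * 1 := by unfold heatKernel; gcongr
    _ ≤ _ := by rw [mul_one]; gcongr

theorem heatFlow_le (μ : Measure ℝ) [IsProbabilityMeasure μ] {a t : ℝ} (ha : 0 < a)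
    (hat : a ≤ t) (x : ℝ) : heatFlow μ 0 t x ≤ (√(2 * Real.pi * a))⁻¹ := by
  have := integral_mono (integrable_heatKernelDeriv_sub μ 0 (ha.trans_le hat) x)
    (integrable_const ((√(2 * Real.pi * a))⁻¹)) (fun y => by
      simp only [heatKernelDeriv_zero]; exact heatKernel_le ha hat (x - y))
  simpa [heatFlow] using this

/-- The Harnack inequality for the heat kernel. -/
theorem heatKernel_harnack {r t : ℝ} (hr : 0 < r) (hrt : r < t) (z w : ℝ) :
    heatKernel r w ≤ √(t / r) * Real.exp ((z - w) ^ 2 / (2 * (t - r))) * heatKernel t z := by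
  have ht := hr.trans hrt
  have hd : 0 < t - r := sub_pos.2 hrt
  have e1 : (√(2 * Real.pi * r))⁻¹ = √(t / r) * (√(2 * Real.pi * t))⁻¹ := by
    rw [← Real.sqrt_inv, ← Real.sqrt_inv, ← Real.sqrt_mul (by positivity)]
    congr 1
    field_simp
  -- The difference of the two sides is a perfect square over a positive denominator.
  have e2 : -w ^ 2 / (2 * r) ≤ (z - w) ^ 2 / (2 * (t - r)) + -z ^ 2 / (2 * t) := by
    have : (z - w) ^ 2 / (2 * (t - r)) + -z ^ 2 / (2 * t) - -w ^ 2 / (2 * r) =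
        (r * z - t * w) ^ 2 / (2 * (t - r) * t * r) := by
      field_simp; ring
    have h0 : 0 ≤ (r * z - t * w) ^ 2 / (2 * (t - r) * t * r) := by positivity
    linarith
  unfold heatKernel
  rw [e1]
  calc √(t / r) * (√(2 * Real.pi * t))⁻¹ * Real.exp (-w ^ 2 / (2 * r))
      ≤ √(t / r) * (√(2 * Real.pi * t))⁻¹ *
        Real.exp ((z - w) ^ 2 / (2 * (t - r)) + -z ^ 2 / (2 * t)) := by gcongr
    _ = _ := by rw [Real.exp_add]; ring

theorem heatFlow_harnack (μ : Measure ℝ) [IsProbabilityMeasure μ] {r t : ℝ} (hr : 0 < r)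
    (hrt : r < t) (x y : ℝ) :
    heatFlow μ 0 r y ≤
      √(t / r) * Real.exp ((x - y) ^ 2 / (2 * (t - r))) * heatFlow μ 0 t x := by
  unfold heatFlow
  rw [← integral_const_mul]
  refine integral_mono (integrable_heatKernelDeriv_sub μ 0 hr y)
    ((integrable_heatKernelDeriv_sub μ 0 (hr.trans hrt) x).const_mul _) fun v => ?_
  simp only [heatKernelDeriv_zero]
  have := heatKernel_harnack hr hrt (x - v) (y - v)
  rwa [sub_sub_sub_cancel_right] at this

/-- The upper bound is the sup bound on p; the lower bound is Harnack from time a/2, where 2(t -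
a/2) ≥ a gives the coefficient 1/a. The point y stays free so that it can be averaged against μ. -/
theorem exists_abs_log_heatFlow_le (μ : Measure ℝ) [IsProbabilityMeasure μ] {a b : ℝ}
    (ha : 0 < a) (hab : a ≤ b) :
    ∃ A, 0 ≤ A ∧ ∀ t, a ≤ t → t ≤ b → ∀ x y,
      |Real.log (heatFlow μ 0 t x)| ≤
        |Real.log (heatFlow μ 0 (a / 2) y)| + (A + 1 / a * (x - y) ^ 2) := by
  set M := (√(2 * Real.pi * a))⁻¹ with hM
  refine ⟨|Real.log √(b / (a / 2))| + |Real.log M|, by positivity, fun t h1 h2 x y => ?_⟩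
  have ht := ha.trans_le h1
  have hr : 0 < a / 2 := half_pos ha
  have hrt : a / 2 < t := by linarith
  have hp := heatFlow_pos μ ht x
  have hp' := heatFlow_pos μ hr y
  have hb := ha.trans_le hab
  have up : Real.log (heatFlow μ 0 t x) ≤ |Real.log M| :=
    (Real.log_le_log hp (heatFlow_le μ ha h1 x)).trans (le_abs_self _)
  have hs : 0 < √(t / (a / 2)) := Real.sqrt_pos.2 (by positivity)
  have low := Real.log_le_log hp' (heatFlow_harnack μ hr hrt x y)
  rw [Real.log_mul (by positivity) hp.ne', Real.log_mul hs.ne' (Real.exp_pos _).ne',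
    Real.log_exp] at low
  have l1 : Real.log √(t / (a / 2)) ≤ |Real.log √(b / (a / 2))| :=
    (Real.log_le_log hs (by gcongr)).trans (le_abs_self _)
  have l2 : (x - y) ^ 2 / (2 * (t - a / 2)) ≤ 1 / a * (x - y) ^ 2 := by
    rw [one_div_mul_eq_div]
    gcongr
    linarith
  have l3 := neg_abs_le (Real.log (heatFlow μ 0 (a / 2) y))
  have n1 : 0 ≤ 1 / a * (x - y) ^ 2 := by positivity
  have n2 := abs_nonneg (Real.log (heatFlow μ 0 (a / 2) y))
  have n3 := abs_nonneg (Real.log √(b / (a / 2)))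
  have n4 := abs_nonneg (Real.log M)
  rw [abs_le]
  constructor <;> linarith

theorem exists_quadratic_mul_exp_le {A B b : ℝ} (hA : 0 ≤ A) (hB : 0 ≤ B) (hb : 0 < b) :
    ∃ C, 0 ≤ C ∧ ∀ z : ℝ, (A + B * z ^ 2) * Real.exp (-(1 / (4 * b)) * z ^ 2) ≤
      C * Real.exp (-(1 / (4 * (2 * b))) * z ^ 2) := by
  obtain ⟨C, hC, h⟩ := exists_pow_le_exp_sq 2 (by positivity : 0 < 2 * b)
  refine ⟨(A + B) * C, by positivity, fun z => ?_⟩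
  have hz := abs_nonneg z
  have h1 : A + B * z ^ 2 ≤ (A + B) * (1 + |z|) ^ 2 := by
    rw [← sq_abs z]
    have e : (A + B) * (1 + |z|) ^ 2 - (A + B * |z| ^ 2) =
      A * (2 * |z| + |z| ^ 2) + B * (1 + 2 * |z|) := by ring
    have : 0 ≤ A * (2 * |z| + |z| ^ 2) + B * (1 + 2 * |z|) := by positivity
    linarith
  calc _ ≤ ((A + B) * (C * Real.exp (z ^ 2 / (4 * (2 * b))))) *
        Real.exp (-(1 / (4 * b)) * z ^ 2) := by
        gcongr
        exact h1.trans (by gcongr; exact h z)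
    _ = (A + B) * C * (Real.exp (z ^ 2 / (4 * (2 * b))) *
        Real.exp (-(1 / (4 * b)) * z ^ 2)) := by ring
    _ = _ := by
        rw [← Real.exp_add]; congr 2; field_simp; ring

theorem measurable_log_heatFlow (μ : Measure ℝ) [IsProbabilityMeasure μ] :
    Measurable (fun q : ℝ × ℝ => Real.log (heatFlow μ 0 q.1 q.2)) :=
  (measurable_heatFlow μ 0).log

/-- If the heat flow has finite entropy at an earlier time, the logarithm of the flow is integrable
against the initial measure. -/
theorem integrable_log_heatFlow (μ : Measure ℝ) [IsProbabilityMeasure μ] {r : ℝ} (hr : 0 < r)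
    (hfin : Integrable fun x => heatFlow μ 0 (r / 2) x * Real.log (heatFlow μ 0 (r / 2) x)) :
    Integrable (fun y => Real.log (heatFlow μ 0 r y)) μ := by
  have hs : 0 < r / 2 := half_pos hr
  obtain ⟨A, hA, hlog⟩ := exists_abs_log_heatFlow_le μ hr le_rfl
  obtain ⟨C, hC, hK⟩ := exists_heatKernelDeriv_le 0 hs le_rfl
  obtain ⟨C', hC', hE⟩ := exists_quadratic_mul_exp_le hA (by positivity : 0 ≤ 1 / r) hs
  have mK : Measurable fun q : ℝ × ℝ => heatKernel (r / 2) (q.1 - q.2) :=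
    measurable_heatKernel.comp
      (by fun_prop : Measurable fun q : ℝ × ℝ => ((r / 2 : ℝ), q.1 - q.2))
  have mL (t : ℝ) : Measurable fun x => Real.log (heatFlow μ 0 t x) :=
    (measurable_log_heatFlow μ).comp measurable_prodMk_left
  -- Writing p at time r/2 as a kernel average turns finite entropy into joint integrability in (x,
  -- y).
  have i1 : Integrable (fun q : ℝ × ℝ =>
      heatKernel (r / 2) (q.1 - q.2) * Real.log (heatFlow μ 0 (r / 2) q.1)) (volume.prod μ) := by
    have hm : AEStronglyMeasurable (fun q : ℝ × ℝ =>
        heatKernel (r / 2) (q.1 - q.2) * Real.log (heatFlow μ 0 (r / 2) q.1)) (volume.prod μ) :=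
      (mK.mul ((mL (r / 2)).comp measurable_fst)).aestronglyMeasurable
    rw [integrable_prod_iff hm]
    refine ⟨ae_of_all _ fun x => ?_, ?_⟩
    · have := integrable_heatKernelDeriv_sub μ 0 hs x
      simp only [heatKernelDeriv_zero] at this
      exact this.mul_const (Real.log (heatFlow μ 0 (r / 2) x))
    · refine hfin.norm.congr (ae_of_all _ fun x => ?_)
      simp only [norm_mul, integral_mul_const]
      congr 1
      rw [Real.norm_of_nonneg (heatFlow_pos μ hs x).le, heatFlow]
      refine integral_congr_ae (ae_of_all _ fun y => ?_)
      simp only [heatKernelDeriv_zero]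
      exact (Real.norm_of_nonneg (heatKernel_pos hs _).le).symm
  have i2 : Integrable (fun q : ℝ × ℝ =>
      C * C' * Real.exp (-(1 / (4 * (2 * (r / 2)))) * (q.1 - q.2) ^ 2) * 1) (volume.prod μ) :=
    integrable_prod_sub_mul μ (w := fun _ => 1)
      (e := fun z => C * C' * Real.exp (-(1 / (4 * (2 * (r / 2)))) * z ^ 2))
      ((integrable_exp_neg_sq (by positivity)).const_mul _) (by fun_prop) (integrable_const 1)
  -- Harnack trades log p_{r/2}(x) for log p_r(y), which no longer depends on x; the kernel then
  -- integrates out in x to 1.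
  have i3 : Integrable (fun q : ℝ × ℝ =>
      heatKernel (r / 2) (q.1 - q.2) * Real.log (heatFlow μ 0 r q.2)) (volume.prod μ) := by
    refine (i1.norm.add i2).mono'
      (mK.mul ((mL r).comp measurable_snd)).aestronglyMeasurable (ae_of_all _ fun q => ?_)
    obtain ⟨x, y⟩ := q
    have hk := heatKernel_pos hs (x - y)
    have h1 := hlog r le_rfl le_rfl y x
    have h2 := hK _ le_rfl le_rfl (x - y)
    rw [heatKernelDeriv_zero, abs_of_pos hk] at h2
    have h3 := hE (x - y)
    simp only [Pi.add_apply, norm_mul, Real.norm_eq_abs, abs_of_pos hk, mul_one]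
    calc heatKernel (r / 2) (x - y) * |Real.log (heatFlow μ 0 r y)|
        ≤ heatKernel (r / 2) (x - y) *
          (|Real.log (heatFlow μ 0 (r / 2) x)| + (A + 1 / r * (y - x) ^ 2)) := by gcongr
      _ = heatKernel (r / 2) (x - y) * |Real.log (heatFlow μ 0 (r / 2) x)| +
          (A + 1 / r * (x - y) ^ 2) * heatKernel (r / 2) (x - y) := by ring
      _ ≤ heatKernel (r / 2) (x - y) * |Real.log (heatFlow μ 0 (r / 2) x)| +
          (A + 1 / r * (x - y) ^ 2) *
            (C * Real.exp (-(1 / (4 * (r / 2))) * (x - y) ^ 2)) := by gcongr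
      _ = heatKernel (r / 2) (x - y) * |Real.log (heatFlow μ 0 (r / 2) x)| +
          C * ((A + 1 / r * (x - y) ^ 2) *
            Real.exp (-(1 / (4 * (r / 2))) * (x - y) ^ 2)) := by ring
      _ ≤ heatKernel (r / 2) (x - y) * |Real.log (heatFlow μ 0 (r / 2) x)| +
          C * (C' * Real.exp (-(1 / (4 * (2 * (r / 2)))) * (x - y) ^ 2)) := by gcongr
      _ = _ := by ring
  refine i3.integral_prod_right.congr (ae_of_all _ fun y => ?_)
  simp only [integral_mul_const]
  rw [integral_sub_right_eq_self (heatKernel (r / 2)), integral_heatKernel hs, one_mul]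

/-- The heat flow started from `μ` has finite entropy at all positive times. -/
def FiniteFlowEntropy (μ : Measure ℝ) : Prop :=
  ∀ t, 0 < t → Integrable fun x => heatFlow μ 0 t x * Real.log (heatFlow μ 0 t x)

theorem locUnifIntegrable_log_mul_heatFlow (μ : Measure ℝ) [IsProbabilityMeasure μ]
    (hfin : FiniteFlowEntropy μ) (k : ℕ) :
    LocUnifIntegrable fun t x => Real.log (heatFlow μ 0 t x) * heatFlow μ k t x := by
  refine locUnifIntegrable_of_le_integral μ
    ((measurable_log_heatFlow μ).mul (measurable_heatFlow μ k)) fun a b ha hab => ?_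
  have hb := ha.trans_le hab
  have hr : 0 < a / 2 := half_pos ha
  obtain ⟨A, hA, hlog⟩ := exists_abs_log_heatFlow_le μ ha hab
  obtain ⟨C, hC, hK⟩ := exists_heatKernelDeriv_le k ha hab
  obtain ⟨C', hC', hE⟩ := exists_quadratic_mul_exp_le (by positivity : 0 ≤ 1 + A)
    (by positivity : 0 ≤ 1 / a) hb
  -- Reference time a/2 for Harnack, hence entropy at a/4. The weight 1 + |log p_{a/2}(y)| is
  -- μ-integrable, and the quadratic cost goes into the Gaussian profile.
  have hl := (integrable_log_heatFlow μ hr (hfin _ (half_pos hr))).abs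
  have hw := (integrable_const (1 : ℝ)).add hl
  refine ⟨fun z => C * C' * Real.exp (-(1 / (4 * (2 * b))) * z ^ 2), _,
    (integrable_exp_neg_sq (by positivity)).const_mul _, by fun_prop, hw, fun t h1 h2 x => ?_⟩
  have ht := ha.trans_le h1
  have step : |Real.log (heatFlow μ 0 t x) * heatFlow μ k t x| ≤
      ∫ y, |Real.log (heatFlow μ 0 t x)| * |heatKernelDeriv k t (x - y)| ∂μ := by
    rw [abs_mul, integral_const_mul]
    gcongr
    exact norm_integral_le_integral_norm (fun y => heatKernelDeriv k t (x - y))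
  refine step.trans (integral_mono_of_nonneg (ae_of_all _ fun y => by positivity) ?_
    (ae_of_all _ fun y => ?_))
  · refine Integrable.bdd_mul (c := C * C') hw (by fun_prop) (ae_of_all _ fun y => ?_)
    rw [Real.norm_of_nonneg (by positivity)]
    refine mul_le_of_le_one_right (by positivity) (Real.exp_le_one_iff.2 ?_)
    have : 0 ≤ 1 / (4 * (2 * b)) * (x - y) ^ 2 := by positivity
    linarith
  · have e1 := hlog t h1 h2 x y
    have e2 := hK t h1 h2 (x - y)
    have e3 := hE (x - y)
    simp only [Pi.add_apply]
    set L := |Real.log (heatFlow μ 0 (a / 2) y)| with hL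
    have hL0 : 0 ≤ L := abs_nonneg _
    have q : 0 ≤ 1 / a * (x - y) ^ 2 := by positivity
    calc |Real.log (heatFlow μ 0 t x)| * |heatKernelDeriv k t (x - y)|
        ≤ (L + (A + 1 / a * (x - y) ^ 2)) *
          (C * Real.exp (-(1 / (4 * b)) * (x - y) ^ 2)) := by gcongr
      _ ≤ ((1 + A + 1 / a * (x - y) ^ 2) * (1 + L)) *
          (C * Real.exp (-(1 / (4 * b)) * (x - y) ^ 2)) := by
          gcongr
          nlinarith
      _ = C * ((1 + A + 1 / a * (x - y) ^ 2) *
          Real.exp (-(1 / (4 * b)) * (x - y) ^ 2)) * (1 + L) := by ring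
      _ ≤ C * (C' * Real.exp (-(1 / (4 * (2 * b))) * (x - y) ^ 2)) * (1 + L) := by gcongr
      _ = _ := by ring

/-! ### De Bruijn's identity -/

theorem flowPoly_X (μ : Measure ℝ) [IsProbabilityMeasure μ] (k : ℕ) {t : ℝ} (ht : 0 < t) (x : ℝ) :
    flowPoly μ (MvPolynomial.X k) t x = heatFlow μ k t x := by
  have := (heatFlow_pos μ ht x).ne'
  simp only [flowPoly, ratioEval, MvPolynomial.eval_X, heatRatio]
  field_simp

theorem locUnifIntegrable_log_add_one_mul_heatFlow (μ : Measure ℝ) [IsProbabilityMeasure μ]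
    (hfin : FiniteFlowEntropy μ) (k : ℕ) :
    LocUnifIntegrable fun t x => (Real.log (heatFlow μ 0 t x) + 1) * heatFlow μ k t x := by
  refine ((locUnifIntegrable_log_mul_heatFlow μ hfin k).add
    (locUnifIntegrable_flowPoly μ (MvPolynomial.X k))).mono
    (((measurable_log_heatFlow μ).add_const 1).mul (measurable_heatFlow μ k)) fun t ht x => ?_
  rw [flowPoly_X μ k ht, add_mul, one_mul]

/-- Integration by parts for the entropy production. -/
theorem integral_log_add_one_mul_heatFlow_two (μ : Measure ℝ) [IsProbabilityMeasure μ]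
    (hfin : FiniteFlowEntropy μ) {t : ℝ} (ht : 0 < t) :
    ∫ x, (Real.log (heatFlow μ 0 t x) + 1) * heatFlow μ 2 t x / 2 =
      -∫ x, flowPoly μ (MvPolynomial.C (1 / 2) * MvPolynomial.X 1 ^ 2) t x := by
  have i2 := (locUnifIntegrable_log_add_one_mul_heatFlow μ hfin 2).integrable ht
  have i1 := (locUnifIntegrable_log_add_one_mul_heatFlow μ hfin 1).integrable ht
  have iJ := (locUnifIntegrable_flowPoly μ
    (MvPolynomial.C (1 / 2) * MvPolynomial.X 1 ^ 2)).integrable ht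
  -- Differentiating (log p + 1)p'/2 in x gives the integrand plus p'²/(2p), which is p u_1²/2.
  have key := integral_eq_zero_of_hasDerivAt_of_integrable
    (f := fun x => (Real.log (heatFlow μ 0 t x) + 1) * heatFlow μ 1 t x / 2)
    (f' := fun x => (Real.log (heatFlow μ 0 t x) + 1) * heatFlow μ 2 t x / 2 +
      flowPoly μ (MvPolynomial.C (1 / 2) * MvPolynomial.X 1 ^ 2) t x) (fun x => ?_)
    ((i2.div_const 2).add iJ) (i1.div_const 2)
  · rw [integral_add (i2.div_const 2) iJ] at key
    linarith
  · have hp := (heatFlow_pos μ ht x).ne'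
    refine (((((hasDerivAt_heatFlow_space μ 0 ht x).log hp).add_const 1).mul
      (hasDerivAt_heatFlow_space μ 1 ht x)).div_const 2).congr_deriv ?_
    simp [flowPoly, ratioEval, heatRatio]
    field_simp
    ring

/-- De Bruijn's identity. -/
theorem hasDerivAt_integral_heatFlow_mul_log (μ : Measure ℝ) [IsProbabilityMeasure μ]
    (hfin : FiniteFlowEntropy μ) {t : ℝ} (ht : 0 < t) :
    HasDerivAt (fun s => ∫ x, heatFlow μ 0 s x * Real.log (heatFlow μ 0 s x))
      (-∫ x, flowPoly μ (MvPolynomial.C (1 / 2) * MvPolynomial.X 1 ^ 2) t x) t := by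
  have hcont (k : ℕ) {s : ℝ} (hs : 0 < s) (x : ℝ) : ContinuousAt (fun s => heatFlow μ k s x) s :=
    (hasDerivAt_heatFlow_time μ k hs x).continuousAt
  rw [← integral_log_add_one_mul_heatFlow_two μ hfin ht]
  refine hasDerivAt_integral_of_locUnifIntegrable
    (F' := fun s x => (Real.log (heatFlow μ 0 s x) + 1) * heatFlow μ 2 s x / 2)
    (fun s hs x => ?_) (fun x s hs => ?_) ?_ hfin ?_ ?_ ht
  · have hp := (heatFlow_pos μ hs x).ne'
    have h0 := hasDerivAt_heatFlow_time μ 0 hs x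
    refine (h0.fun_mul (h0.log hp)).congr_deriv ?_
    field_simp
  · have hp := (heatFlow_pos μ hs x).ne'
    exact (((((hcont 0 hs x).log hp).add continuousAt_const).mul
      (hcont 2 hs x)).div_const 2).continuousWithinAt
  · exact ((((measurable_log_heatFlow μ).add_const 1).mul (measurable_heatFlow μ 2)).div_const 2)
  · have := (locUnifIntegrable_log_add_one_mul_heatFlow μ hfin 2).const_mul (1 / 2)
    refine this.mono ((((measurable_log_heatFlow μ).add_const 1).mul
      (measurable_heatFlow μ 2)).div_const 2) fun s hs x => le_of_eq ?_
    congr 1; ring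
  -- Continuity is read off after integrating by parts, since half the Fisher information is already
  -- known to be differentiable.
  · refine ContinuousOn.congr (f := fun s =>
      -∫ x, flowPoly μ (MvPolynomial.C (1 / 2) * MvPolynomial.X 1 ^ 2) s x) ?_
      fun s hs => integral_log_add_one_mul_heatFlow_two μ hfin hs
    exact fun s hs => (hasDerivAt_integral_flowPoly μ _ hs).continuousAt.neg.continuousWithinAt

/-! ### The sum-of-squares certificate -/

open MvPolynomial in
/-- The potential whose spatial derivative brings the third time derivative of the Fisher
information into the form of a sum of squares. -/
noncomputable def fisherPotential : MvPolynomial ℕ ℝ :=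
  C (1 / 8) * (X 6 * X 1) + C (-1 / 8) * (X 5 * X 2) + C (1 / 16) * (X 5 * X 1 ^ 2)
    + C (1 / 2) * (X 4 * X 3) + C (-5 / 8) * (X 4 * X 2 * X 1) + C (1 / 8) * (X 4 * X 1 ^ 3)
    + C (-9 / 40) * (X 3 ^ 2 * X 1) + C (-3 / 40) * (X 3 * X 2 ^ 2)
    + C (7 / 20) * (X 3 * X 2 * X 1 ^ 2) + C (-1 / 8) * (X 3 * X 1 ^ 4)
    + C (37 / 150) * (X 2 ^ 3 * X 1) + C (-151 / 600) * (X 2 ^ 2 * X 1 ^ 3)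
    + C (17 / 125) * (X 2 * X 1 ^ 5) + C (-379 / 17500) * X 1 ^ 7

/-- With v_k of weight k, everything here is homogeneous of weight 8: three time derivatives add 6
to u_1², and one space derivative adds 1 to the weight-7 potential. It is a formal identity in free
variables, so it can be checked by expansion. -/
theorem eval_iterate_ratioDeriv_fisher (v : ℕ → ℝ) :
    MvPolynomial.eval v (ratioDeriv 2 (1 / 2) (ratioDeriv 2 (1 / 2) (ratioDeriv 2 (1 / 2)
      (MvPolynomial.C (1 / 2) * MvPolynomial.X 1 ^ 2)))) =
    MvPolynomial.eval v (ratioDeriv 1 1 fisherPotential) - 1 / 2 *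
      ((v 4 - 6 / 5 * (v 3 * v 1) - 7 / 10 * v 2 ^ 2 + 8 / 5 * (v 2 * v 1 ^ 2)
          - 1 / 2 * v 1 ^ 4) ^ 2
        + (2 / 5 * (v 3 * v 1) - 1 / 3 * (v 2 * v 1 ^ 2) + 9 / 100 * v 1 ^ 4) ^ 2
        + (-4 / 100 * (v 2 * v 1 ^ 2) + 4 / 100 * v 1 ^ 4) ^ 2
        + 1 / 300 * v 2 ^ 4 + 56 / 90000 * (v 2 ^ 2 * v 1 ^ 4) + 13 / 70000 * v 1 ^ 8) := by
  simp only [ratioDeriv, fisherPotential, map_add, map_sub, Derivation.leibniz,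
    Derivation.leibniz_pow, MvPolynomial.mkDerivation_X, MvPolynomial.derivation_C, Derivation.map_natCast,
    smul_eq_mul, nsmul_eq_mul, map_mul, map_pow, MvPolynomial.eval_X, MvPolynomial.eval_C,
    map_zero, map_natCast]
  norm_num
  ring

theorem integral_iterate_ratioDeriv_fisher_nonpos (μ : Measure ℝ) [IsProbabilityMeasure μ]
    {t : ℝ} (ht : 0 < t) :
    ∫ x, flowPoly μ (ratioDeriv 2 (1 / 2) (ratioDeriv 2 (1 / 2) (ratioDeriv 2 (1 / 2)
      (MvPolynomial.C (1 / 2) * MvPolynomial.X 1 ^ 2)))) t x ≤ 0 := by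
  rw [← integral_flowPoly_ratioDeriv_space μ fisherPotential ht]
  refine integral_mono ((locUnifIntegrable_flowPoly μ _).integrable ht)
    ((locUnifIntegrable_flowPoly μ _).integrable ht) fun x => ?_
  refine mul_le_mul_of_nonneg_left ?_ (heatFlow_pos μ ht x).le
  simp only [ratioEval]
  rw [eval_iterate_ratioDeriv_fisher, sub_le_self_iff]
  positivity

/-! ### From random variables to the heat flow -/

theorem map_add_gaussian_eq_withDensity {Ω : Type*} [MeasurableSpace Ω] {P : Measure Ω}
    [IsProbabilityMeasure P] {X Z : Ω → ℝ} (hX : AEMeasurable X P) {t : ℝ} (ht : 0 < t)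
    (hZ : HasLaw Z (gaussianReal 0 t.toNNReal) P) (hXZ : IndepFun X Z P) :
    P.map (fun ω => X ω + Z ω) =
      volume.withDensity fun x => ENNReal.ofReal (heatFlow (P.map X) 0 t x) := by
  have : IsProbabilityMeasure (P.map X) := Measure.isProbabilityMeasure_map hX
  have hv : t.toNNReal ≠ 0 := by simpa using ht
  have h1 : P.map (fun ω => X ω + Z ω) = P.map X ∗ gaussianReal 0 t.toNNReal := by
    rw [← hZ.map_eq]
    exact hXZ.map_add_eq_map_conv_map₀ hX hZ.aemeasurable
  have hm : Measurable fun q : ℝ × ℝ => ENNReal.ofReal (heatKernel t (q.1 - q.2)) :=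
    (measurable_heatKernel.comp
      (by fun_prop : Measurable fun q : ℝ × ℝ => (t, q.1 - q.2))).ennreal_ofReal
  ext s hs
  rw [h1, ← lintegral_indicator_one hs, Measure.lintegral_conv (measurable_one.indicator hs),
    withDensity_apply _ hs]
  have inner (y : ℝ) : ∫⁻ z, s.indicator 1 (y + z) ∂gaussianReal 0 t.toNNReal =
      ∫⁻ x in s, ENNReal.ofReal (heatKernel t (x - y)) := by
    rw [gaussianReal_of_var_ne_zero 0 hv, lintegral_withDensity_eq_lintegral_mul _
      (measurable_gaussianPDF 0 _) (by fun_prop (disch := assumption)),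
      ← lintegral_indicator hs, ← lintegral_sub_right_eq_self _ y]
    refine lintegral_congr fun x => ?_
    simp only [Pi.mul_apply, gaussianPDF, ← heatKernel_eq_gaussianPDFReal ht, add_sub_cancel]
    by_cases h : x ∈ s <;> simp [h]
  simp only [inner]
  rw [lintegral_lintegral_swap]
  · refine lintegral_congr fun x => ?_
    have hi := integrable_heatKernelDeriv_sub (P.map X) 0 ht x
    rw [heatFlow, ofReal_integral_eq_lintegral_ofReal hi]
    · simp only [heatKernelDeriv_zero]
    · refine ae_of_all _ fun y => ?_
      simp only [heatKernelDeriv_zero]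
      exact (heatKernel_pos ht _).le
  · exact (hm.comp measurable_swap).aemeasurable

theorem densityMulLog_ae_eq {Ω : Type*} [MeasurableSpace Ω] {P : Measure Ω}
    [IsProbabilityMeasure P] {X Z : Ω → ℝ} (hX : AEMeasurable X P) {t : ℝ} (ht : 0 < t)
    (hZ : HasLaw Z (gaussianReal 0 t.toNNReal) P) (hXZ : IndepFun X Z P) :
    densityMulLog (fun ω => X ω + Z ω) P =ᵐ[volume] fun x =>
      heatFlow (P.map X) 0 t x * Real.log (heatFlow (P.map X) 0 t x) := by
  have : IsProbabilityMeasure (P.map X) := Measure.isProbabilityMeasure_map hX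
  have hm : Measurable fun x => heatFlow (P.map X) 0 t x :=
    (measurable_heatFlow (P.map X) 0).comp measurable_prodMk_left
  have h : pdf (fun ω => X ω + Z ω) P volume =ᵐ[volume]
      fun x => ENNReal.ofReal (heatFlow (P.map X) 0 t x) := by
    rw [pdf_def, map_add_gaussian_eq_withDensity hX ht hZ hXZ]
    exact Measure.rnDeriv_withDensity _ hm.ennreal_ofReal
  filter_upwards [h] with x hx
  rw [densityMulLog, hx, ENNReal.toReal_ofReal (heatFlow_pos _ ht x).le]

/-- Successive derivatives on the positive half-line give the iterated derivatives there. -/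
theorem iteratedDeriv_eq_of_hasDerivAt {f : ℝ → ℝ} {g : ℕ → ℝ → ℝ} {n : ℕ}
    (h0 : ∀ t, 0 < t → f t = g 0 t)
    (h : ∀ k, k < n → ∀ t, 0 < t → HasDerivAt (g k) (g (k + 1) t) t) :
    ∀ k, k ≤ n → ∀ t, 0 < t → iteratedDeriv k f t = g k t := by
  intro k
  induction k with
  | zero => simpa using h0
  | succ k ih =>
    intro hk t ht
    rw [iteratedDeriv_succ]
    have he : iteratedDeriv k f =ᶠ[nhds t] g k := by
      filter_upwards [Ioi_mem_nhds ht] with s hs using ih (by omega) s hs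
    rw [he.deriv_eq]
    exact (h k (by omega) t ht).deriv

theorem differentiableAt_iteratedDeriv_of_hasDerivAt {f : ℝ → ℝ} {g : ℕ → ℝ → ℝ} {n : ℕ}
    (h0 : ∀ t, 0 < t → f t = g 0 t)
    (h : ∀ k, k < n → ∀ t, 0 < t → HasDerivAt (g k) (g (k + 1) t) t) {k : ℕ} (hk : k < n)
    {t : ℝ} (ht : 0 < t) : DifferentiableAt ℝ (iteratedDeriv k f) t := by
  refine ((h k hk t ht).congr_of_eventuallyEq ?_).differentiableAt
  filter_upwards [Ioi_mem_nhds ht] with s hs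
  exact iteratedDeriv_eq_of_hasDerivAt h0 h k hk.le s hs

/-- The entropy of the heat flow and its time derivatives. -/
noncomputable def flowEntropyDeriv (μ : Measure ℝ) : ℕ → ℝ → ℝ
  | 0, t => -∫ x, heatFlow μ 0 t x * Real.log (heatFlow μ 0 t x)
  | k + 1, t => ∫ x, flowPoly μ ((ratioDeriv 2 (1 / 2))^[k]
      (MvPolynomial.C (1 / 2) * MvPolynomial.X 1 ^ 2)) t x

theorem hasDerivAt_flowEntropyDeriv (μ : Measure ℝ) [IsProbabilityMeasure μ]
    (hfin : FiniteFlowEntropy μ) (k : ℕ) {t : ℝ} (ht : 0 < t) :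
    HasDerivAt (flowEntropyDeriv μ k) (flowEntropyDeriv μ (k + 1) t) t := by
  cases k with
  | zero =>
    refine (hasDerivAt_integral_heatFlow_mul_log μ hfin ht).neg.congr_deriv ?_
    simp [flowEntropyDeriv]
  | succ k =>
    simp only [flowEntropyDeriv, Function.iterate_succ_apply']
    exact hasDerivAt_integral_flowPoly μ _ ht

theorem mainTheorem3 {Ω : Type*} [MeasurableSpace Ω] (P : Measure Ω) [IsProbabilityMeasure P]
    (X : Ω → ℝ) (hX : HasPDF X P volume)
    (Z : ℝ → Ω → ℝ)
    (hZ : ∀ t : ℝ, 0 < t → HasLaw (Z t) (gaussianReal 0 t.toNNReal) P)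
    (hXZ : ∀ t : ℝ, 0 < t → IndepFun X (Z t) P)
    (hfin : ∀ t : ℝ, 0 < t → FiniteDiffEntropy (fun ω => X ω + Z t ω) P) :
    ∀ t : ℝ, 0 < t →
      (∀ k : ℕ, k < 4 →
        DifferentiableAt ℝ
          (iteratedDeriv k (fun s : ℝ => diffEntropy (fun ω => X ω + Z s ω) P)) t) ∧
      0 ≤ -iteratedDeriv 4 (fun s : ℝ => diffEntropy (fun ω => X ω + Z s ω) P) t := by
  have hXm : AEMeasurable X P := hX.aemeasurable
  have : IsProbabilityMeasure (P.map X) := Measure.isProbabilityMeasure_map hXm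
  have hflow : FiniteFlowEntropy (P.map X) := fun t ht =>
    (hfin t ht).congr (densityMulLog_ae_eq hXm ht (hZ t ht) (hXZ t ht))
  have h0 (t : ℝ) (ht : 0 < t) :
      diffEntropy (fun ω => X ω + Z t ω) P = flowEntropyDeriv (P.map X) 0 t := by
    rw [diffEntropy, integral_congr_ae (densityMulLog_ae_eq hXm ht (hZ t ht) (hXZ t ht))]
    rfl
  have h (k : ℕ) (_ : k < 4) (t : ℝ) (ht : 0 < t) :=
    hasDerivAt_flowEntropyDeriv (P.map X) hflow k ht
  refine fun t ht => ⟨fun k hk => differentiableAt_iteratedDeriv_of_hasDerivAt h0 h hk ht, ?_⟩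
  rw [iteratedDeriv_eq_of_hasDerivAt h0 h 4 le_rfl t ht, neg_nonneg]
  -- De Bruijn uses one derivative, so the fourth is three iterations of the time operator on
  -- u_1²/2.
  exact integral_iterate_ratioDeriv_fisher_nonpos (P.map X) ht
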